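/- \textbf{Setting.} Let $z_1,\dots,z_n$ ($n\ge 1$) be i.i.d. data points with law $P$ on a measurable space. Each data point $z$ has a feature vector $a_z\in\mathbb{R}^d$ and a scalar loss $\ell_z:\mathbb{R}\to\mathbb{R}$ that is twice differentiable, and all the $\ell_z$ have the same second derivative: $\ell_z''=\ell_{z'}''$ for all $z,z'$. Let $\lambda>0$, assume that $\ell_z(a_z^\top x)$ is $P$-integrable for every $x\in\mathbb{R}^d$, and put $$f(x)=\frac1n\sum_{i=1}^n \ell_{z_i}(a_{z_i}^\top x)+\frac\lambda2\|x\|^2,\qquad F(x)=\mathbb{E}_{z\sim P}\big[\ell_z(a_z^\top x)\big]+\frac\lambda2\|x\|^2,$$ with Hessians $H_f(x)=\nabla^2 f(x)$ and $H_F(x)=\nabla^2F(x)$. (In particular, $P$ may be the uniform distribution on a data set of $N$ points; then $F$ is the average loss over the whole data set and $f$ the average loss over $n$ points sampled from it with replacement.) \textbf{Theorem.} Let $D\ge 0$, $R$, $B_\ell\in\mathbb{R}$ and $M_\ell\ge 0$, and let $\mathcal{B}(0,D)$ be the closed Euclidean ball of radius $D$ in $\mathbb{R}^d$. Assume that $\|a_z\|\le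 R$ for $P$-almost every $z$, that each $\ell_z''$ is $M_\ell$-Lipschitz on $\mathbb{R}$, and that for $P$-almost every $z$ one has $0\le \ell_z''(a_z^\top x)\le B_\ell$ for all $x\in\mathcal{B}(0,D)$. Then for every $0<\delta\le 1$, with probability at least $1-\delta$, $$\sup_{x\in\mathcal{B}(0,D)}\|H_f(x)-H_F(x)\|_{\rm op}\le \mu=\sqrt{4\pi}\,\frac{R^2}{\sqrt n}\left(B_\ell\left[2+\sqrt{\frac{1}{2\pi}\log(\delta^{-1})}\right]+R\,M_\ell\,D\right).$$ The bound does not depend on the dimension $d$. -/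

import Mathlib

open MeasureTheory ProbabilityTheory
open scoped NNReal ENNReal RealInnerProductSpace

noncomputable section

/-- The Hessian of `g : ℝ^d → ℝ` at `x`, as a linear operator on Euclidean space: the Fréchet
derivative of the gradient. Its norm is the operator norm (largest singular value). -/
def hessian {d : ℕ} (g : EuclideanSpace ℝ (Fin d) → ℝ) (x : EuclideanSpace ℝ (Fin d)) :
    EuclideanSpace ℝ (Fin d) →L[ℝ] EuclideanSpace ℝ (Fin d) :=
  fderiv ℝ (gradient g) x

/-- The loss of the data point `z` in a regularized linear model with feature map `a` and scalar
losses `l`: `ℓ(x, z) = ℓ_z(a_zᵀ x) + (lam / 2) ‖x‖²`. -/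
def linearModelLoss {Z : Type*} {d : ℕ} (a : Z → EuclideanSpace ℝ (Fin d)) (l : Z → ℝ → ℝ)
    (lam : ℝ) (x : EuclideanSpace ℝ (Fin d)) (z : Z) : ℝ :=
  l z ⟪a z, x⟫ + lam / 2 * ‖x‖ ^ 2

/-- The empirical risk `f(x) = (1 / n) ∑ i, ℓ(x, z_i)` of a sample `s = (z_1, …, z_n)`. -/
def sampleRisk {Z : Type*} {d n : ℕ} (a : Z → EuclideanSpace ℝ (Fin d)) (l : Z → ℝ → ℝ)
    (lam : ℝ) (s : Fin n → Z) (x : EuclideanSpace ℝ (Fin d)) : ℝ :=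
  1 / (n : ℝ) * ∑ i, linearModelLoss a l lam x (s i)

/-- The overall risk `F(x) = 𝔼 ℓ(x, z)` for `z` with law `P`. When `P` is the uniform distribution
on a finite data set of `N` points, it is the average of `ℓ(x, ·)` over that data set. -/
def overallRisk {Z : Type*} [MeasurableSpace Z] {d : ℕ} (P : Measure Z)
    (a : Z → EuclideanSpace ℝ (Fin d)) (l : Z → ℝ → ℝ) (lam : ℝ)
    (x : EuclideanSpace ℝ (Fin d)) : ℝ :=
  ∫ z, linearModelLoss a l lam x z ∂P

end

/-! All losses share one second derivative `h`, so the regularizers cancel and `H_f(x) - H_F(x)` is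
the centered average of `h ⟪a_z, x⟫ • a_z a_zᵀ`. Its operator norm is the supremum of its pairings
with `v wᵀ`, for `v`, `w` in the unit ball. Enlarging these rank-one matrices to all `W` in the
Frobenius unit ball gives an empirical process `h ⟪a_z, x⟫ * ⟪b_z, W⟫`, with `b_z = a_z a_zᵀ`,
indexed by two Hilbert balls. Only norms enter from here on (`‖b_z‖ ≤ R²`), hence no dimension and
no covering numbers.

The supremum concentrates by McDiarmid (`measureReal_pi_ge_le`): one point moves the sum by at most
`2BR²`, which gives the logarithmic term. Its mean is bounded by symmetrization and a contraction
principle with two independent signs (`ciSup_add_add_ciSup_sub_le`): the process is Lipschitz in the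
larger of a multiple of `⟪b_z, W⟫` and a multiple of `⟪a_z, x⟫`, so it may be replaced by a signed
sum of these two linear functionals. The supremum of a linear functional over a ball is a norm, and
the parallelogram law makes signed sums grow like `√n` (`integral_ciSup_linear_add_sum_le`).

Suprema are taken over finite index sets, where measurability is clear. Since the bound does not
depend on the set, it passes to a dense sequence and, by continuity, to both balls. -/

section FiniteSup

/-! ### Finite suprema and the two-sign contraction step. -/

variable {ι : Type*} [Finite ι]

lemma le_ciSup_of_finite (g : ι → ℝ) (t : ι) : g t ≤ ⨆ t, g t :=
  le_ciSup (Set.finite_range g).bddAbove t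

variable [Nonempty ι]

lemma abs_ciSup_le_of_finite {g : ι → ℝ} {K : ℝ} (h : ∀ t, |g t| ≤ K) : |⨆ t, g t| ≤ K := by
  obtain ⟨t, ht⟩ := exists_eq_ciSup_of_finite (f := g)
  rw [← ht]; exact h t

/-- One step of the contraction principle for Rademacher averages, for functions that are
1-Lipschitz in the maximum of two coordinates. -/
lemma ciSup_add_add_ciSup_sub_le (A φ u v : ι → ℝ)
    (h : ∀ t t', |φ t - φ t'| ≤ max |u t - u t'| |v t - v t'|) :
    2 * ((⨆ t, (A t + φ t)) + ⨆ t, (A t - φ t)) ≤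
      (⨆ t, (A t + (u t + v t))) + (⨆ t, (A t + (u t - v t))) +
        (⨆ t, (A t + (-u t + v t))) + ⨆ t, (A t + (-u t - v t)) := by
  obtain ⟨t, ht⟩ := exists_eq_ciSup_of_finite (f := fun t => A t + φ t)
  obtain ⟨t', ht'⟩ := exists_eq_ciSup_of_finite (f := fun t => A t - φ t)
  rw [← ht, ← ht']
  have h1 := le_ciSup_of_finite (fun t => A t + (u t + v t))
  have h2 := le_ciSup_of_finite (fun t => A t + (u t - v t))
  have h3 := le_ciSup_of_finite (fun t => A t + (-u t + v t))
  have h4 := le_ciSup_of_finite (fun t => A t + (-u t - v t))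
  have h5 := (le_abs_self _).trans (h t t')
  have a1 := h1 t; have a2 := h2 t; have a3 := h3 t; have a4 := h4 t
  have b1 := h1 t'; have b2 := h2 t'; have b3 := h3 t'; have b4 := h4 t'
  -- If `φ t - φ t' ≤ u t - u t'`, evaluate the two suprema containing `+u` at `t` and the two
  -- containing `-u` at `t'`: the `v` terms cancel. The other cases exchange `t` with `t'` or `u`
  -- with `v`.
  rcases le_max_iff.1 h5 with h6 | h6 <;> rcases le_abs.1 h6 with h7 | h7 <;> linarith

end FiniteSup

/-! ### Bounded functions on product spaces; Hoeffding and McDiarmid. -/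

lemma integrable_of_abs_le {Z : Type*} [MeasurableSpace Z] {P : Measure Z} [IsFiniteMeasure P]
    {g : Z → ℝ} (hg : Measurable g) {K : ℝ} (hK : ∀ z, |g z| ≤ K) : Integrable g P :=
  Integrable.of_bound hg.aestronglyMeasurable K (ae_of_all _ hK)

lemma abs_integral_le_of_abs_le {Z : Type*} [MeasurableSpace Z] {P : Measure Z}
    [IsProbabilityMeasure P] {g : Z → ℝ} {K : ℝ} (hK : ∀ z, |g z| ≤ K) : |∫ z, g z ∂P| ≤ K := by
  simpa using norm_integral_le_of_norm_le_const (μ := P) (f := g) (ae_of_all _ hK)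

section Pi

variable {Z : Type*} [MeasurableSpace Z] {P : Measure Z} [IsProbabilityMeasure P]

lemma measurable_fin_cons {n : ℕ} :
    Measurable fun q : Z × (Fin n → Z) => (Fin.cons q.1 q.2 : Fin (n + 1) → Z) := by
  refine measurable_pi_lambda _ fun i => ?_
  refine Fin.cases ?_ (fun j => ?_) i
  · simpa using measurable_fst
  · simpa [Function.comp_def] using (measurable_pi_apply j).comp measurable_snd

lemma integral_pi_succ_eq_prod {n : ℕ} (G : (Fin (n + 1) → Z) → ℝ) :
    ∫ z, G z ∂Measure.pi (fun _ => P) =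
      ∫ q : Z × (Fin n → Z), G (Fin.cons q.1 q.2) ∂P.prod (Measure.pi fun _ => P) := by
  have h := (measurePreserving_piFinSuccAbove (fun _ : Fin (n + 1) => P) 0).symm
  rw [← h.integral_comp' G]
  simp [MeasurableEquiv.piFinSuccAbove, Fin.insertNthEquiv]

lemma integral_pi_succ {n : ℕ} {G : (Fin (n + 1) → Z) → ℝ} (hG : Measurable G) {K : ℝ}
    (hK : ∀ z, |G z| ≤ K) :
    ∫ z, G z ∂Measure.pi (fun _ => P) =
      ∫ y, ∫ r : Fin n → Z, G (Fin.cons y r) ∂Measure.pi (fun _ => P) ∂P := by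
  rw [integral_pi_succ_eq_prod, integral_prod]
  exact integrable_of_abs_le (hG.comp measurable_fin_cons) fun _ => hK _

lemma integral_pi_succ_symm {n : ℕ} {G : (Fin (n + 1) → Z) → ℝ} (hG : Measurable G) {K : ℝ}
    (hK : ∀ z, |G z| ≤ K) :
    ∫ z, G z ∂Measure.pi (fun _ => P) =
      ∫ r : Fin n → Z, ∫ y, G (Fin.cons y r) ∂P ∂Measure.pi (fun _ => P) := by
  rw [integral_pi_succ_eq_prod, integral_prod_symm]
  exact integrable_of_abs_le (hG.comp measurable_fin_cons) fun _ => hK _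

/-- **Hoeffding's lemma** for a function of bounded oscillation. -/
lemma integral_exp_mul_sub_integral_le {g : Z → ℝ} (hg : Measurable g) {c : ℝ}
    (hc : ∀ y z, g y - g z ≤ c) (s : ℝ) :
    ∫ z, Real.exp (s * (g z - ∫ z, g z ∂P)) ∂P ≤ Real.exp (c ^ 2 / 4 * s ^ 2 / 2) := by
  obtain ⟨z₀⟩ : Nonempty Z := P.nonempty_of_neZero
  have hb : BddBelow (Set.range g) := ⟨g z₀ - c, by rintro _ ⟨z, rfl⟩; linarith [hc z₀ z]⟩
  have hm : ∀ z, g z ∈ Set.Icc (⨅ z, g z) ((⨅ z, g z) + c) := fun z => by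
    refine ⟨ciInf_le hb z, ?_⟩
    have : Nonempty Z := ⟨z⟩
    have : g z - c ≤ ⨅ z, g z := le_ciInf fun y => by linarith [hc z y]
    linarith
  have := (hasSubgaussianMGF_of_mem_Icc hg.aemeasurable (ae_of_all P hm)).mgf_le s
  refine this.trans_eq ?_
  congr 2
  simp [div_pow]
  norm_num

/-- The moment generating function bound behind **McDiarmid's inequality**. -/
lemma integral_exp_mul_sub_integral_pi_le {n : ℕ} {G : (Fin n → Z) → ℝ} (hG : Measurable G)
    {K c : ℝ} (hK : ∀ z, |G z| ≤ K)
    (hc : ∀ z i y y', G (Function.update z i y) - G (Function.update z i y') ≤ c) (s : ℝ) :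
    ∫ z, Real.exp (s * (G z - ∫ z, G z ∂Measure.pi fun _ => P)) ∂Measure.pi (fun _ => P) ≤
      Real.exp (n * c ^ 2 / 4 * s ^ 2 / 2) := by
  induction n with
  | zero =>
    have : ∀ z, G z = G Fin.elim0 := fun z => congrArg G (Subsingleton.elim _ _)
    simp [this]
  | succ n ih =>
    have hcons : ∀ y, Measurable fun r : Fin n → Z => G (Fin.cons y r) := fun y =>
      hG.comp (measurable_fin_cons.comp (measurable_const.prodMk measurable_id))
    -- Conditional mean of `G` given the first point. It inherits oscillation `c`, so Hoeffding's
    -- lemma handles `g - 𝔼 g`, while the induction hypothesis handles `G - g` for each fixed first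
    -- point.
    set g : Z → ℝ := fun y => ∫ r : Fin n → Z, G (Fin.cons y r) ∂Measure.pi (fun _ => P) with hg
    have hgm : Measurable g :=
      (StronglyMeasurable.integral_prod_right'
        (hG.comp measurable_fin_cons).stronglyMeasurable).measurable
    have hgK : ∀ y, |g y| ≤ K := fun y => abs_integral_le_of_abs_le fun r => hK _
    have hEG : ∫ z, G z ∂Measure.pi (fun _ => P) = ∫ y, g y ∂P := integral_pi_succ hG hK
    have hgc : ∀ y y', g y - g y' ≤ c := fun y y' => by
      rw [hg, ← integral_sub (integrable_of_abs_le (hcons y) fun _ => hK _)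
        (integrable_of_abs_le (hcons y') fun _ => hK _)]
      have : ∀ r : Fin n → Z, G (Fin.cons y r) - G (Fin.cons y' r) ≤ c := fun r => by
        simpa using hc (Fin.cons y r) 0 y y'
      refine (integral_mono (integrable_of_abs_le (K := K + K) ((hcons y).sub (hcons y'))
        fun r => ?_) (integrable_const c) this).trans_eq (by simp)
      exact (abs_sub _ _).trans (add_le_add (hK _) (hK _))
    rw [hEG, integral_pi_succ (G := fun z => Real.exp (s * (G z - ∫ y, g y ∂P)))
      (K := Real.exp (|s| * (K + |∫ y, g y ∂P|))) (by fun_prop)]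
    · have hin : ∀ y, ∫ r : Fin n → Z, Real.exp (s * (G (Fin.cons y r) - ∫ y, g y ∂P))
          ∂Measure.pi (fun _ => P) ≤
          Real.exp (n * c ^ 2 / 4 * s ^ 2 / 2) * Real.exp (s * (g y - ∫ y, g y ∂P)) := fun y => by
        have h1 := ih (hcons y) (fun _ => hK _) (fun z i w w' => by
          have := hc (Fin.cons y z) i.succ w w'
          simpa only [← Fin.cons_update] using this)
        have h2 := mul_le_mul_of_nonneg_right h1 (Real.exp_pos (s * (g y - ∫ y, g y ∂P))).le
        rw [← integral_mul_const] at h2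
        refine le_trans (le_of_eq ?_) h2
        refine integral_congr_ae (ae_of_all _ fun r => ?_)
        simp only [← Real.exp_add]
        congr 1
        simp only [hg]
        ring
      have hint : Integrable (fun y => Real.exp (s * (g y - ∫ y, g y ∂P))) P := by
        refine integrable_of_abs_le (K := Real.exp (|s| * (K + |∫ y, g y ∂P|))) (by fun_prop)
          fun y => ?_
        rw [abs_of_pos (Real.exp_pos _), Real.exp_le_exp]
        refine (le_abs_self _).trans ?_
        rw [abs_mul]
        gcongr
        exact (abs_sub _ _).trans (by gcongr; exact hgK y)
      calc _ ≤ ∫ y, Real.exp (n * c ^ 2 / 4 * s ^ 2 / 2) *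
            Real.exp (s * (g y - ∫ y, g y ∂P)) ∂P :=
            integral_mono_of_nonneg (ae_of_all _ fun y => integral_nonneg fun _ =>
              (Real.exp_pos _).le) (hint.const_mul _) (ae_of_all _ hin)
        _ ≤ Real.exp (n * c ^ 2 / 4 * s ^ 2 / 2) * Real.exp (c ^ 2 / 4 * s ^ 2 / 2) := by
            rw [integral_const_mul]
            gcongr
            exact integral_exp_mul_sub_integral_le hgm hgc s
        _ = _ := by
            rw [← Real.exp_add]
            congr 1
            push_cast
            ring
    · intro z
      rw [abs_of_pos (Real.exp_pos _), Real.exp_le_exp]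
      refine (le_abs_self _).trans ?_
      rw [abs_mul]
      gcongr
      exact (abs_sub _ _).trans (by gcongr; exact hK z)

/-- **McDiarmid's inequality** for i.i.d. variables. -/
lemma measureReal_pi_ge_le {n : ℕ} {G : (Fin n → Z) → ℝ} (hG : Measurable G)
    {K c : ℝ} (hK : ∀ z, |G z| ≤ K)
    (hc : ∀ z i y y', G (Function.update z i y) - G (Function.update z i y') ≤ c)
    {ε : ℝ} (hε : 0 ≤ ε) :
    (Measure.pi fun _ : Fin n => P).real
        {z | ε ≤ G z - ∫ z, G z ∂Measure.pi fun _ => P} ≤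
      Real.exp (-ε ^ 2 / (2 * (n * c ^ 2 / 4))) := by
  have hp : 0 ≤ n * c ^ 2 / 4 := by positivity
  have : HasSubgaussianMGF (fun z => G z - ∫ z, G z ∂Measure.pi fun _ => P)
      (n * c ^ 2 / 4).toNNReal (Measure.pi fun _ : Fin n => P) := by
    refine ⟨fun s => ?_, fun s => ?_⟩
    · refine integrable_of_abs_le
        (K := Real.exp (|s| * (K + |∫ z, G z ∂Measure.pi fun _ => P|))) (by fun_prop) fun z => ?_
      rw [abs_of_pos (Real.exp_pos _), Real.exp_le_exp]
      refine (le_abs_self _).trans ?_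
      rw [abs_mul]
      gcongr
      exact (abs_sub _ _).trans (by gcongr; exact hK z)
    · rw [Real.coe_toNNReal _ hp]
      exact integral_exp_mul_sub_integral_pi_le hG hK hc s
  have h := this.measure_ge_le hε
  rwa [Real.coe_toNNReal _ hp] at h

end Pi

/-! ### Symmetrization, contraction and the expected supremum. -/

lemma sqrt_norm_add_sq_add_sqrt_norm_sub_sq_le {V : Type*} [NormedAddCommGroup V]
    [InnerProductSpace ℝ V] (v w : V) {c : ℝ} (hc : 0 ≤ c) :
    √(‖v + w‖ ^ 2 + c) + √(‖v - w‖ ^ 2 + c) ≤ 2 * √(‖v‖ ^ 2 + (‖w‖ ^ 2 + c)) := by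
  have h1 := Real.sq_sqrt (show 0 ≤ ‖v + w‖ ^ 2 + c by positivity)
  have h2 := Real.sq_sqrt (show 0 ≤ ‖v - w‖ ^ 2 + c by positivity)
  have h3 := Real.sq_sqrt (show 0 ≤ ‖v‖ ^ 2 + (‖w‖ ^ 2 + c) by positivity)
  -- For the two roots `p`, `q` on the left, `(p + q)² ≤ 2 (p² + q²)`, and the parallelogram law
  -- turns the latter into exactly the square of the right-hand side.
  have h4 := parallelogram_law_with_norm ℝ v w
  refine abs_le_of_sq_le_sq' (?_ : _ ≤ _) (by positivity) |>.2
  nlinarith [sq_nonneg (√(‖v + w‖ ^ 2 + c) - √(‖v - w‖ ^ 2 + c))]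

section Symmetrization

variable {Z : Type*} [MeasurableSpace Z] {P : Measure Z} [IsProbabilityMeasure P]
variable {ι : Type*} [Finite ι] [Nonempty ι]

lemma integrable_ciSup_add {A : ι → ℝ} {f : ι → Z → ℝ} (hf : ∀ t, Measurable (f t)) {K : ℝ}
    (hK : ∀ t z, |f t z| ≤ K) : Integrable (fun z => ⨆ t, (A t + f t z)) P := by
  refine integrable_of_abs_le (K := (⨆ t, |A t|) + K)
    (Measurable.iSup fun t => (hf t).const_add _) fun z => abs_ciSup_le_of_finite fun t => ?_
  exact (abs_add_le _ _).trans (add_le_add (le_ciSup_of_finite (fun t => |A t|) t) (hK t z))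

/-- Symmetrization followed by contraction, for a single random point. -/
lemma integral_ciSup_add_sub_integral_le (A : ι → ℝ) {f u v : ι → Z → ℝ}
    (hf : ∀ t, Measurable (f t)) (hu : ∀ t, Measurable (u t)) (hv : ∀ t, Measurable (v t))
    {K : ℝ} (hfK : ∀ t z, |f t z| ≤ K) (huK : ∀ t z, |u t z| ≤ K) (hvK : ∀ t z, |v t z| ≤ K)
    (h : ∀ t t' z, |f t z - f t' z| ≤ max |u t z - u t' z| |v t z - v t' z|) :
    ∫ z, (⨆ t, (A t + (f t z - ∫ z, f t z ∂P))) ∂P ≤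
      ∫ z, 1 / 4 * ((⨆ t, (A t + (2 * u t z + 2 * v t z))) +
        (⨆ t, (A t + (2 * u t z - 2 * v t z))) + (⨆ t, (A t + (-(2 * u t z) + 2 * v t z))) +
        ⨆ t, (A t + (-(2 * u t z) - 2 * v t z))) ∂P := by
  have hadd : ∀ a b : ℝ, |a| ≤ K → |b| ≤ K →
      |2 * a + 2 * b| ≤ 4 * K ∧ |2 * a - 2 * b| ≤ 4 * K ∧ |-(2 * a) + 2 * b| ≤ 4 * K ∧
        |-(2 * a) - 2 * b| ≤ 4 * K := fun a b ha hb => by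
    rw [abs_le] at ha hb
    refine ⟨?_, ?_, ?_, ?_⟩ <;> rw [abs_le] <;> constructor <;> linarith
  have hfi : ∀ t, Integrable (f t) P := fun t => integrable_of_abs_le (hf t) (hfK t)
  have ip : Integrable (fun z => ⨆ t, (A t + 2 * f t z)) P :=
    integrable_ciSup_add (f := fun t z => 2 * f t z) (K := 2 * K)
      (fun t => (hf t).const_mul 2) fun t z => by rw [abs_mul, abs_two]; linarith [hfK t z]
  have im : Integrable (fun z => ⨆ t, (A t - 2 * f t z)) P := by
    simp only [sub_eq_add_neg]
    exact integrable_ciSup_add (f := fun t z => -(2 * f t z)) (K := 2 * K)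
      (fun t => ((hf t).const_mul 2).neg) fun t z => by
        rw [abs_neg, abs_mul, abs_two]; linarith [hfK t z]
  have i0 : Integrable (fun z => ⨆ t, (A t + (f t z - ∫ z, f t z ∂P))) P :=
    integrable_ciSup_add (f := fun t z => f t z - ∫ z, f t z ∂P) (K := K + K)
      (fun t => (hf t).sub_const _) fun t z =>
        (abs_sub _ _).trans (add_le_add (hfK t z) (abs_integral_le_of_abs_le (hfK t)))
  have i1 : Integrable (fun z => ⨆ t, (A t + (2 * u t z + 2 * v t z))) P :=
    integrable_ciSup_add (f := fun t z => 2 * u t z + 2 * v t z)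
      (fun t => by have := hu t; have := hv t; fun_prop) fun t z => (hadd _ _ (huK t z) (hvK t z)).1
  have i2 : Integrable (fun z => ⨆ t, (A t + (2 * u t z - 2 * v t z))) P :=
    integrable_ciSup_add (f := fun t z => 2 * u t z - 2 * v t z)
      (fun t => by have := hu t; have := hv t; fun_prop)
      fun t z => (hadd _ _ (huK t z) (hvK t z)).2.1
  have i3 : Integrable (fun z => ⨆ t, (A t + (-(2 * u t z) + 2 * v t z))) P :=
    integrable_ciSup_add (f := fun t z => -(2 * u t z) + 2 * v t z)
      (fun t => by have := hu t; have := hv t; fun_prop)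
      fun t z => (hadd _ _ (huK t z) (hvK t z)).2.2.1
  have i4 : Integrable (fun z => ⨆ t, (A t + (-(2 * u t z) - 2 * v t z))) P :=
    integrable_ciSup_add (f := fun t z => -(2 * u t z) - 2 * v t z)
      (fun t => by have := hu t; have := hv t; fun_prop)
      fun t z => (hadd _ _ (huK t z) (hvK t z)).2.2.2
  -- Symmetrization by convexity: split `A t` into two halves and push the supremum inside the
  -- integral that defines the mean. The factor 2 on `f` is the usual symmetrization loss.
  have hpt : ∀ z, (⨆ t, (A t + (f t z - ∫ z, f t z ∂P))) ≤
      1 / 2 * (⨆ t, (A t + 2 * f t z)) + 1 / 2 * ∫ y, (⨆ t, (A t - 2 * f t y)) ∂P := fun z => by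
    refine ciSup_le fun t => ?_
    have h1 := le_ciSup_of_finite (fun t => A t + 2 * f t z) t
    have h2 : A t - 2 * ∫ y, f t y ∂P ≤ ∫ y, (⨆ t, (A t - 2 * f t y)) ∂P := by
      have : ∫ y, (A t - 2 * f t y) ∂P = A t - 2 * ∫ y, f t y ∂P := by
        rw [integral_sub (integrable_const _) ((hfi t).const_mul 2), integral_const_mul]
        simp
      rw [← this]
      exact integral_mono ((integrable_const _).sub ((hfi t).const_mul 2)) im
        fun y => le_ciSup_of_finite (fun t => A t - 2 * f t y) t
    linarith
  calc _ ≤ ∫ z, (1 / 2 * (⨆ t, (A t + 2 * f t z)) +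
          1 / 2 * ∫ y, (⨆ t, (A t - 2 * f t y)) ∂P) ∂P :=
        integral_mono i0 ((ip.const_mul _).add (integrable_const _)) hpt
    _ = ∫ z, (1 / 2 * (⨆ t, (A t + 2 * f t z)) + 1 / 2 * (⨆ t, (A t - 2 * f t z))) ∂P := by
        rw [integral_add (ip.const_mul _) (integrable_const _),
          integral_add (ip.const_mul _) (im.const_mul _), integral_const_mul, integral_const_mul]
        simp [integral_const_mul]
    _ ≤ _ := by
        refine integral_mono ((ip.const_mul _).add (im.const_mul _))
          ((((i1.add i2).add i3).add i4).const_mul _) fun z => ?_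
        have := ciSup_add_add_ciSup_sub_le A (fun t => 2 * f t z) (fun t => 2 * u t z)
          (fun t => 2 * v t z) fun t t' => by
            simp only [← mul_sub, abs_mul, abs_two]
            rw [← mul_max_of_nonneg _ _ zero_le_two]
            linarith [h t t' z]
        dsimp only
        linarith

variable {V E : Type*} [NormedAddCommGroup V] [InnerProductSpace ℝ V]
  [NormedAddCommGroup E] [InnerProductSpace ℝ E]

/-- The expected supremum of an empirical process indexed by functions that are Lipschitz in two
linear functionals, plus a fixed linear term. -/
lemma integral_ciSup_linear_add_sum_le {f : ι → Z → ℝ} {W : ι → V} {x : ι → E} {b : Z → V}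
    {a : Z → E} {ρ₁ ρ₂ β₁ β₂ K : ℝ}
    (hW : ∀ t, ‖W t‖ ≤ ρ₁) (hx : ∀ t, ‖x t‖ ≤ ρ₂) (hb : ∀ z, ‖b z‖ ≤ β₁) (ha : ∀ z, ‖a z‖ ≤ β₂)
    (hf : ∀ t, Measurable (f t)) (hbm : ∀ t, Measurable fun z => ⟪b z, W t⟫)
    (ham : ∀ t, Measurable fun z => ⟪a z, x t⟫) (hfK : ∀ t z, |f t z| ≤ K)
    (h : ∀ t t' z, |f t z - f t' z| ≤ max |⟪b z, W t⟫ - ⟪b z, W t'⟫| |⟪a z, x t⟫ - ⟪a z, x t'⟫|)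
    (n : ℕ) (v : V) (y : E) :
    ∫ z : Fin n → Z, (⨆ t, (⟪v, W t⟫ + ⟪y, x t⟫ + ∑ i, (f t (z i) - ∫ z, f t z ∂P)))
        ∂Measure.pi (fun _ => P) ≤
      ρ₁ * √(‖v‖ ^ 2 + n * (4 * β₁ ^ 2)) + ρ₂ * √(‖y‖ ^ 2 + n * (4 * β₂ ^ 2)) := by
  have hρ₁ : 0 ≤ ρ₁ := (norm_nonneg _).trans (hW (Classical.arbitrary ι))
  have hρ₂ : 0 ≤ ρ₂ := (norm_nonneg _).trans (hx (Classical.arbitrary ι))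
  have hm : ∀ (n : ℕ) (v : V) (y : E) t, Measurable fun z : Fin n → Z =>
      ⟪v, W t⟫ + ⟪y, x t⟫ + ∑ i, (f t (z i) - ∫ z, f t z ∂P) := fun n v y t => by
    have := hf t
    fun_prop
  have hmK : ∀ (n : ℕ) (v : V) (y : E) t (z : Fin n → Z),
      |⟪v, W t⟫ + ⟪y, x t⟫ + ∑ i, (f t (z i) - ∫ z, f t z ∂P)| ≤
        ‖v‖ * ρ₁ + ‖y‖ * ρ₂ + n * (K + K) := fun n v y t z => by
    refine (abs_add_le _ _).trans (add_le_add ((abs_add_le _ _).trans (add_le_add ?_ ?_)) ?_)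
    · exact (abs_real_inner_le_norm _ _).trans (by gcongr; exact hW t)
    · exact (abs_real_inner_le_norm _ _).trans (by gcongr; exact hx t)
    · refine (Finset.abs_sum_le_sum_abs _ _).trans ?_
      refine (Finset.sum_le_sum (g := fun _ => K + K) fun i _ => (abs_sub _ _).trans
        (add_le_add (hfK t _) (abs_integral_le_of_abs_le (hfK t)))).trans_eq
          (by simp [mul_add])
  have hSm := fun n v y => Measurable.iSup (hm n v y)
  have hSK := fun n v y z => abs_ciSup_le_of_finite fun t => hmK n v y t z
  induction n generalizing v y with
  | zero =>
    simp only [Finset.univ_eq_empty, Finset.sum_empty, add_zero, integral_const, Nat.cast_zero,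
      zero_mul, Real.sqrt_sq (norm_nonneg _), probReal_univ, one_smul]
    refine ciSup_le fun t => add_le_add ?_ ?_
    · rw [mul_comm]
      exact (real_inner_le_norm _ _).trans (by gcongr; exact hW t)
    · rw [mul_comm]
      exact (real_inner_le_norm _ _).trans (by gcongr; exact hx t)
  | succ n ih =>
    -- The linear term is kept general so that it can absorb the signed vectors `±2 b z`, `±2 a z`
    -- of each point already processed. `Q` averages over the four sign choices.
    set Φ : V → E → (Fin n → Z) → ℝ := fun v y r =>
      ⨆ t, (⟪v, W t⟫ + ⟪y, x t⟫ + ∑ i, (f t (r i) - ∫ z, f t z ∂P)) with hΦ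
    set Q : Z → (Fin n → Z) → ℝ := fun z r => 1 / 4 *
      (Φ (v + (2 : ℝ) • b z) (y + (2 : ℝ) • a z) r + Φ (v + (2 : ℝ) • b z) (y - (2 : ℝ) • a z) r +
      Φ (v - (2 : ℝ) • b z) (y + (2 : ℝ) • a z) r + Φ (v - (2 : ℝ) • b z) (y - (2 : ℝ) • a z) r)
      with hQ
    have hβ₁ : ∀ z, ‖(2 : ℝ) • b z‖ ≤ 2 * β₁ := fun z => by
      rw [norm_smul]; simpa using hb z
    have hβ₂ : ∀ z, ‖(2 : ℝ) • a z‖ ≤ 2 * β₂ := fun z => by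
      rw [norm_smul]; simpa using ha z
    have hΦi : ∀ v y, Integrable (Φ v y) (Measure.pi fun _ => P) := fun v y =>
      integrable_of_abs_le (hSm n v y) (hSK n v y)
    have hΦm : ∀ (c e : ℝ), Measurable fun q : Z × (Fin n → Z) =>
        Φ (v + c • b q.1) (y + e • a q.1) q.2 := fun c e => by
      refine Measurable.iSup fun t => ?_
      have h1 : Measurable fun q : Z × (Fin n → Z) => ⟪b q.1, W t⟫ := (hbm t).comp measurable_fst
      have h2 : Measurable fun q : Z × (Fin n → Z) => ⟪a q.1, x t⟫ := (ham t).comp measurable_fst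
      have h3 := hf t
      simp only [inner_add_left, real_inner_smul_left]
      fun_prop
    have hΦK : ∀ (c e : ℝ) (q : Z × (Fin n → Z)), |Φ (v + c • b q.1) (y + e • a q.1) q.2| ≤
        (‖v‖ + |c| * β₁) * ρ₁ + (‖y‖ + |e| * β₂) * ρ₂ + n * (K + K) := fun c e q => by
      refine (hSK n _ _ _).trans ?_
      have h1 : ‖v + c • b q.1‖ ≤ ‖v‖ + |c| * β₁ := (norm_add_le _ _).trans (by
        rw [norm_smul, Real.norm_eq_abs]; gcongr; exact hb _)
      have h2 : ‖y + e • a q.1‖ ≤ ‖y‖ + |e| * β₂ := (norm_add_le _ _).trans (by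
        rw [norm_smul, Real.norm_eq_abs]; gcongr; exact ha _)
      gcongr
    have hΦpi : ∀ (c e : ℝ), Integrable (fun q : Z × (Fin n → Z) =>
        Φ (v + c • b q.1) (y + e • a q.1) q.2) (P.prod (Measure.pi fun _ => P)) := fun c e =>
      integrable_of_abs_le (hΦm c e) (hΦK c e)
    have hQi : Integrable (fun q : Z × (Fin n → Z) => Q q.1 q.2)
        (P.prod (Measure.pi fun _ => P)) := by
      have := ((((hΦpi 2 2).add (hΦpi 2 (-2))).add (hΦpi (-2) 2)).add
        (hΦpi (-2) (-2))).const_mul (1 / 4)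
      simpa only [hQ, neg_smul, ← sub_eq_add_neg, Pi.add_apply] using this
    have step : ∀ r : Fin n → Z, ∫ z, (⨆ t, (⟪v, W t⟫ + ⟪y, x t⟫ +
        ∑ i, (f t ((Fin.cons z r : Fin (n + 1) → Z) i) - ∫ z, f t z ∂P))) ∂P ≤
        ∫ z, Q z r ∂P := fun r => by
      have huK : ∀ t z, |⟪b z, W t⟫| ≤ max K (max (β₁ * ρ₁) (β₂ * ρ₂)) := fun t z =>
        ((abs_real_inner_le_norm _ _).trans (mul_le_mul (hb z) (hW t) (norm_nonneg _)
          ((norm_nonneg _).trans (hb z)))).trans ((le_max_left _ _).trans (le_max_right _ _))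
      have hvK : ∀ t z, |⟪a z, x t⟫| ≤ max K (max (β₁ * ρ₁) (β₂ * ρ₂)) := fun t z =>
        ((abs_real_inner_le_norm _ _).trans (mul_le_mul (ha z) (hx t) (norm_nonneg _)
          ((norm_nonneg _).trans (ha z)))).trans ((le_max_right _ _).trans (le_max_right _ _))
      have := integral_ciSup_add_sub_integral_le (P := P)
        (fun t => ⟪v, W t⟫ + ⟪y, x t⟫ + ∑ i, (f t (r i) - ∫ z, f t z ∂P))
        hf hbm ham (fun t z => (hfK t z).trans (le_max_left _ _)) huK hvK h
      convert this using 4 with z z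
      · ext t
        rw [Fin.sum_univ_succ]
        simp only [Fin.cons_zero, Fin.cons_succ]
        ring
      · simp only [hΦ, inner_add_left, inner_sub_left, real_inner_smul_left]
        refine congrArg₂ (· + ·) (congrArg₂ (· + ·) (congrArg₂ (· + ·) ?_ ?_) ?_) ?_ <;>
          exact iSup_congr fun t => by ring
    -- The new point is integrated first, with the others frozen inside `A t`. Fubini then exchanges
    -- the order, so that the induction hypothesis applies with the new point fixed.
    rw [integral_pi_succ_symm (hSm (n + 1) v y) (hSK (n + 1) v y)]
    have hQin : ∀ z, ∫ r, Q z r ∂Measure.pi (fun _ => P) ≤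
        ρ₁ * √(‖v‖ ^ 2 + (n + 1 : ℕ) * (4 * β₁ ^ 2)) +
          ρ₂ * √(‖y‖ ^ 2 + (n + 1 : ℕ) * (4 * β₂ ^ 2)) := fun z => by
      have e1 := ih (v + (2 : ℝ) • b z) (y + (2 : ℝ) • a z)
      have e2 := ih (v + (2 : ℝ) • b z) (y - (2 : ℝ) • a z)
      have e3 := ih (v - (2 : ℝ) • b z) (y + (2 : ℝ) • a z)
      have e4 := ih (v - (2 : ℝ) • b z) (y - (2 : ℝ) • a z)
      -- Averaging over the signs adds `‖2 b z‖² ≤ 4 β₁²` under the root: one more term of the sum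
      -- over points.
      have c1 := sqrt_norm_add_sq_add_sqrt_norm_sub_sq_le v ((2 : ℝ) • b z)
        (c := n * (4 * β₁ ^ 2)) (by positivity)
      have c2 := sqrt_norm_add_sq_add_sqrt_norm_sub_sq_le y ((2 : ℝ) • a z)
        (c := n * (4 * β₂ ^ 2)) (by positivity)
      have d1 : √(‖v‖ ^ 2 + (‖(2 : ℝ) • b z‖ ^ 2 + n * (4 * β₁ ^ 2))) ≤
          √(‖v‖ ^ 2 + (n + 1 : ℕ) * (4 * β₁ ^ 2)) := by
        apply Real.sqrt_le_sqrt
        have := pow_le_pow_left₀ (norm_nonneg _) (hβ₁ z) 2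
        push_cast
        linarith
      have d2 : √(‖y‖ ^ 2 + (‖(2 : ℝ) • a z‖ ^ 2 + n * (4 * β₂ ^ 2))) ≤
          √(‖y‖ ^ 2 + (n + 1 : ℕ) * (4 * β₂ ^ 2)) := by
        apply Real.sqrt_le_sqrt
        have := pow_le_pow_left₀ (norm_nonneg _) (hβ₂ z) 2
        push_cast
        linarith
      have f1 := mul_le_mul_of_nonneg_left (c1.trans (mul_le_mul_of_nonneg_left d1 zero_le_two)) hρ₁
      have f2 := mul_le_mul_of_nonneg_left (c2.trans (mul_le_mul_of_nonneg_left d2 zero_le_two)) hρ₂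
      simp only [hQ]
      rw [integral_const_mul, integral_add, integral_add, integral_add]
      · linarith
      · exact hΦi _ _
      · exact hΦi _ _
      · exact (hΦi _ _).add (hΦi _ _)
      · exact hΦi _ _
      · exact ((hΦi _ _).add (hΦi _ _)).add (hΦi _ _)
      · exact hΦi _ _
    calc _ ≤ ∫ r, ∫ z, Q z r ∂P ∂Measure.pi (fun _ => P) := by
          refine integral_mono ?_ hQi.integral_prod_right step
          exact (integrable_of_abs_le ((hSm (n + 1) v y).comp measurable_fin_cons)
            fun q => hSK (n + 1) v y _).integral_prod_right
      _ = ∫ z, ∫ r, Q z r ∂Measure.pi (fun _ => P) ∂P := by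
          rw [integral_integral_swap]
          exact hQi.swap
      _ ≤ _ := by
          refine (integral_mono hQi.integral_prod_left (integrable_const _) hQin).trans_eq ?_
          simp

end Symmetrization

/-! ### High-probability bound over finitely many indices. -/

lemma ciSup_sub_ciSup_le_of_finite {ι : Type*} [Finite ι] [Nonempty ι] {g g' : ι → ℝ} {c : ℝ}
    (h : ∀ t, g t - g' t ≤ c) : (⨆ t, g t) - ⨆ t, g' t ≤ c := by
  rw [sub_le_iff_le_add]
  exact ciSup_le fun t => by linarith [h t, le_ciSup_of_finite g' t]

section Deviation

variable {Z : Type*} [MeasurableSpace Z] {P : Measure Z} [IsProbabilityMeasure P]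
variable {V E : Type*} [NormedAddCommGroup V] [InnerProductSpace ℝ V]
  [NormedAddCommGroup E] [InnerProductSpace ℝ E]

/-- A high-probability bound on the supremum, over finitely many pairs `(x t, W t)`, of the
centered sums of `z ↦ h ⟪a z, x t⟫ * ⟪b z, W t⟫`. -/
lemma measureReal_pi_lt_ciSup_sum_le {ι : Type*} [Finite ι] [Nonempty ι] {n : ℕ} (hn : 0 < n)
    {a : Z → E} {b : Z → V} {x : ι → E} {W : ι → V} {h : ℝ → ℝ} {R D B δ : ℝ} {M : ℝ≥0}
    (hR : 0 ≤ R) (ha : ∀ z, ‖a z‖ ≤ R) (hb : ∀ z, ‖b z‖ ≤ R ^ 2)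
    (hx : ∀ t, ‖x t‖ ≤ D) (hW : ∀ t, ‖W t‖ ≤ 1)
    (ham : ∀ t, Measurable fun z => ⟪a z, x t⟫) (hbm : ∀ t, Measurable fun z => ⟪b z, W t⟫)
    (hM : LipschitzWith M h) (h0 : ∀ s, 0 ≤ h s) (hB : ∀ s, h s ≤ B)
    (hδ0 : 0 < δ) (hδ1 : δ ≤ 1) :
    (Measure.pi fun _ : Fin n => P).real {z | √(4 * Real.pi) * R ^ 2 * √n *
        (B * (2 + √(1 / (2 * Real.pi) * Real.log (1 / δ))) + R * M * D) <
      ⨆ t, ∑ i, (h ⟪a (z i), x t⟫ * ⟪b (z i), W t⟫ - ∫ z, h ⟪a z, x t⟫ * ⟪b z, W t⟫ ∂P)} ≤ δ := by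
  have hB0 : 0 ≤ B := (h0 0).trans (hB 0)
  have hD : 0 ≤ D := (norm_nonneg _).trans (hx (Classical.arbitrary ι))
  set L := Real.log (1 / δ) with hL
  have hL0 : 0 ≤ L := Real.log_nonneg (by rw [le_div_iff₀ hδ0]; linarith)
  set f : ι → Z → ℝ := fun t z => h ⟪a z, x t⟫ * ⟪b z, W t⟫ with hf
  have hbW : ∀ t z, |⟪b z, W t⟫| ≤ R ^ 2 := fun t z =>
    (abs_real_inner_le_norm _ _).trans ((mul_le_mul (hb z) (hW t) (norm_nonneg _)
      (by positivity)).trans_eq (mul_one _))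
  have habs : ∀ s, |h s| ≤ B := fun s => by rw [abs_of_nonneg (h0 s)]; exact hB s
  have hfK : ∀ t z, |f t z| ≤ B * R ^ 2 := fun t z => by
    rw [hf, abs_mul]
    exact mul_le_mul (habs _) (hbW t z) (abs_nonneg _) hB0
  have hfm : ∀ t, Measurable (f t) := fun t => (hM.continuous.measurable.comp (ham t)).mul (hbm t)
  set S : (Fin n → Z) → ℝ := fun z => ⨆ t, ∑ i, (f t (z i) - ∫ z, f t z ∂P) with hS
  have hSm : Measurable S := Measurable.iSup fun t => by have := hfm t; fun_prop
  have hSK : ∀ z, |S z| ≤ n * (B * R ^ 2 + B * R ^ 2) := fun z =>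
    abs_ciSup_le_of_finite fun t => by
      refine (Finset.abs_sum_le_sum_abs _ _).trans ?_
      refine (Finset.sum_le_sum (g := fun _ => B * R ^ 2 + B * R ^ 2) fun i _ =>
        (abs_sub _ _).trans (add_le_add (hfK t _) (abs_integral_le_of_abs_le (hfK t)))).trans_eq
          (by simp [mul_add])
  have hSc : ∀ z i y y', S (Function.update z i y) - S (Function.update z i y') ≤
      2 * B * R ^ 2 := fun z i y y' => by
    classical
    refine ciSup_sub_ciSup_le_of_finite fun t => ?_
    rw [← Finset.sum_sub_distrib, Finset.sum_eq_single i]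
    · have h1 := (abs_le.1 (hfK t y)).2
      have h2 := (abs_le.1 (hfK t y')).1
      simp only [Function.update_self]
      linarith
    · intro j _ hj
      simp [Function.update_of_ne hj]
    · simp
  have hES : ∫ z, S z ∂Measure.pi (fun _ => P) ≤
      √n * (14 / 3 * (B * R ^ 2) + 7 / 2 * (R ^ 3 * M * D)) := by
    -- The weights satisfy `3/7 + 4/7 = 1`, so `p + q ≤ max (7/3 p) (7/4 q)`. After the
    -- symmetrization factor 2 they become `14/3` and `7/2`, which fit below `2√(4π)` and `√(4π)`.
    have key := integral_ciSup_linear_add_sum_le (P := P) (f := f) (W := W) (x := x)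
      (b := fun z => (7 / 3 * B) • b z) (a := fun z => (7 / 4 * R ^ 2 * M) • a z)
      (ρ₁ := 1) (ρ₂ := D) (β₁ := 7 / 3 * B * R ^ 2) (β₂ := 7 / 4 * R ^ 2 * M * R)
      (K := B * R ^ 2) hW hx
      (fun z => by
        rw [norm_smul, Real.norm_of_nonneg (by positivity)]
        exact mul_le_mul_of_nonneg_left (hb z) (by positivity))
      (fun z => by
        rw [norm_smul, Real.norm_of_nonneg (by positivity)]
        exact mul_le_mul_of_nonneg_left (ha z) (by positivity))
      hfm (fun t => by simpa only [real_inner_smul_left] using (hbm t).const_mul _)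
      (fun t => by simpa only [real_inner_smul_left] using (ham t).const_mul _) hfK ?_ n 0 0
    · have e : ∀ c : ℝ, 0 ≤ c → √(n * (4 * c ^ 2)) = √n * (2 * c) := fun c hc => by
        rw [Real.sqrt_mul (Nat.cast_nonneg n), show 4 * c ^ 2 = (2 * c) ^ 2 by ring,
          Real.sqrt_sq (by positivity)]
      simp only [inner_zero_left, norm_zero, zero_add, ne_eq, OfNat.ofNat_ne_zero,
        not_false_eq_true, zero_pow] at key
      rw [e _ (by positivity), e _ (by positivity)] at key
      refine key.trans_eq ?_
      ring
    · intro t t' z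
      simp only [real_inner_smul_left, ← mul_sub, abs_mul]
      rw [abs_of_nonneg (show (0 : ℝ) ≤ 7 / 4 by norm_num), abs_of_nonneg (sq_nonneg R),
        NNReal.abs_eq, abs_of_nonneg (show (0 : ℝ) ≤ 7 / 3 by norm_num), abs_of_nonneg hB0]
      have h1 : |h ⟪a z, x t⟫ - h ⟪a z, x t'⟫| ≤ M * |⟪a z, x t⟫ - ⟪a z, x t'⟫| := by
        simpa [Real.dist_eq] using hM.dist_le_mul ⟪a z, x t⟫ ⟪a z, x t'⟫
      have h2 : |f t z - f t' z| ≤ B * |⟪b z, W t⟫ - ⟪b z, W t'⟫| +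
          R ^ 2 * (M * |⟪a z, x t⟫ - ⟪a z, x t'⟫|) := by
        rw [show f t z - f t' z = h ⟪a z, x t⟫ * (⟪b z, W t⟫ - ⟪b z, W t'⟫) +
          ⟪b z, W t'⟫ * (h ⟪a z, x t⟫ - h ⟪a z, x t'⟫) by simp only [hf]; ring]
        refine (abs_add_le _ _).trans ?_
        rw [abs_mul, abs_mul]
        gcongr
        · exact habs _
        · exact hbW _ _
      have h3 := le_max_left (7 / 3 * B * |⟪b z, W t⟫ - ⟪b z, W t'⟫|)
        (7 / 4 * R ^ 2 * M * |⟪a z, x t⟫ - ⟪a z, x t'⟫|)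
      have h4 := le_max_right (7 / 3 * B * |⟪b z, W t⟫ - ⟪b z, W t'⟫|)
        (7 / 4 * R ^ 2 * M * |⟪a z, x t⟫ - ⟪a z, x t'⟫|)
      linarith
  have hpi : 7 / 2 ≤ √(4 * Real.pi) := by
    apply Real.le_sqrt_of_sq_le
    linarith [Real.pi_gt_d2]
  have hsq : √(4 * Real.pi) * √(1 / (2 * Real.pi) * L) = √(2 * L) := by
    rw [← Real.sqrt_mul (by positivity)]
    congr 1
    field_simp
    norm_num
  have hT : √n * (14 / 3 * (B * R ^ 2) + 7 / 2 * (R ^ 3 * M * D)) + B * R ^ 2 * √(2 * L) * √n ≤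
      √(4 * Real.pi) * R ^ 2 * √n * (B * (2 + √(1 / (2 * Real.pi) * L)) + R * M * D) := by
    have e : √(4 * Real.pi) * R ^ 2 * √n * (B * (2 + √(1 / (2 * Real.pi) * L)) + R * M * D) =
        √n * (√(4 * Real.pi) * (2 * (B * R ^ 2) + R ^ 3 * M * D)) +
        B * R ^ 2 * (√(4 * Real.pi) * √(1 / (2 * Real.pi) * L)) * √n := by ring
    rw [e, hsq]
    gcongr
    have h1 : 0 ≤ B * R ^ 2 := by positivity
    have h2 : 0 ≤ R ^ 3 * M * D := by positivity
    nlinarith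
  -- If `B * R ^ 2 = 0`, the exponent in McDiarmid's bound is `0 / 0 = 0` and the bound is the
  -- trivial 1; but then the process vanishes identically.
  rcases (show 0 ≤ B * R ^ 2 by positivity).eq_or_lt with hz | hpos
  · have hf0 : ∀ t z, f t z = 0 := fun t z => abs_nonpos_iff.1 ((hfK t z).trans hz.ge)
    have hS0 : ∀ z, S z = 0 := fun z => by simp [hS, hf0]
    refine le_of_eq_of_le ?_ hδ0.le
    convert measureReal_empty
    ext z
    simp only [Set.mem_ofPred_eq, Set.mem_empty_iff_false, iff_false, not_lt]
    change S z ≤ _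
    rw [hS0]
    positivity
  · have hn' : (0 : ℝ) < n := by exact_mod_cast hn
    have hmc := measureReal_pi_ge_le (P := P) hSm hSK hSc
      (ε := B * R ^ 2 * √(2 * L) * √n) (by positivity)
    refine (measureReal_mono ?_).trans (hmc.trans_eq ?_)
    · intro z hz
      simp only [Set.mem_ofPred_eq] at hz ⊢
      change _ < S z at hz
      linarith
    · have : -(B * R ^ 2 * √(2 * L) * √n) ^ 2 / (2 * (n * (2 * B * R ^ 2) ^ 2 / 4)) = -L := by
        rw [mul_pow, mul_pow, Real.sq_sqrt (by positivity), Real.sq_sqrt hn'.le]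
        have : B ≠ 0 := by rintro rfl; simp at hpos
        have : R ≠ 0 := by rintro rfl; simp at hpos
        field_simp
        ring
      rw [this, hL, ← Real.log_inv, Real.exp_log (by positivity)]
      simp

end Deviation

/-! ### Hessians of the empirical and overall risks. -/

section Hessian

variable {E F : Type*} [NormedAddCommGroup E] [InnerProductSpace ℝ E]
  [NormedAddCommGroup F] [InnerProductSpace ℝ F]

lemma hasFDerivAt_comp_inner_smul {k : ℝ → ℝ} (hk : Differentiable ℝ k) (a x : E) (w : F) :
    HasFDerivAt (fun x => k ⟪a, x⟫ • w)
      (deriv k ⟪a, x⟫ • InnerProductSpace.rankOne ℝ w a) x := by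
  have h1 : HasFDerivAt (fun x : E => ⟪a, x⟫) (innerSL ℝ a) x := (innerSL ℝ a).hasFDerivAt
  have h2 := ((hk ⟪a, x⟫).hasDerivAt.comp_hasFDerivAt x h1).smul_const w
  refine h2.congr_fderiv ?_
  ext y
  simp [mul_smul]

lemma integrable_comp_inner_smul {Z : Type*} [MeasurableSpace Z] {P : Measure Z}
    [IsFiniteMeasure P] {G : Type*} [NormedAddCommGroup G] [NormedSpace ℝ G] {k : ℝ → ℝ}
    (hk : Continuous k) {a : Z → E} {w : Z → G} (ha : AEStronglyMeasurable a P)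
    (hw : AEStronglyMeasurable w P) {R C : ℝ} (hR : ∀ᵐ z ∂P, ‖a z‖ ≤ R)
    (hC : ∀ᵐ z ∂P, ‖w z‖ ≤ C) (x : E) : Integrable (fun z => k ⟪a z, x⟫ • w z) P := by
  obtain ⟨c, hc⟩ := (isCompact_Icc (a := -(R * ‖x‖)) (b := R * ‖x‖)).exists_bound_of_continuousOn
    hk.continuousOn
  refine Integrable.of_bound ((hk.comp_aestronglyMeasurable
    (ha.inner aestronglyMeasurable_const)).smul hw) (c * C) ?_
  filter_upwards [hR, hC] with z h1 h2
  rw [norm_smul]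
  have h3 : ⟪a z, x⟫ ∈ Set.Icc (-(R * ‖x‖)) (R * ‖x‖) :=
    abs_le.1 ((abs_real_inner_le_norm _ _).trans (by gcongr))
  exact mul_le_mul (hc _ h3) h2 (norm_nonneg _) ((norm_nonneg _).trans (hc _ h3))

lemma aestronglyMeasurable_rankOne {Z : Type*} [MeasurableSpace Z] {P : Measure Z} {a : Z → E}
    {w : Z → F} (ha : AEStronglyMeasurable a P) (hw : AEStronglyMeasurable w P) :
    AEStronglyMeasurable (fun z => InnerProductSpace.rankOne ℝ (w z) (a z)) P := by
  have hc : Continuous fun q : F × E => InnerProductSpace.rankOne ℝ q.1 q.2 :=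
    (ContinuousLinearMap.smulRightL ℝ E F).continuous₂.comp
      (((innerSL ℝ).continuous.comp continuous_snd).prodMk continuous_fst)
  exact hc.comp_aestronglyMeasurable (f := fun z => (w z, a z)) (hw.prodMk ha)

lemma hasFDerivAt_integral_comp_inner_smul {Z : Type*} [MeasurableSpace Z] {P : Measure Z}
    [IsFiniteMeasure P] {k : ℝ → ℝ}
    (hk : Differentiable ℝ k) (hk' : Continuous (deriv k)) {a : Z → E} {w : Z → F}
    (ha : AEStronglyMeasurable a P) (hw : AEStronglyMeasurable w P) {R C : ℝ}
    (hR : ∀ᵐ z ∂P, ‖a z‖ ≤ R) (hC : ∀ᵐ z ∂P, ‖w z‖ ≤ C) (x : E) :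
    HasFDerivAt (fun x => ∫ z, k ⟪a z, x⟫ • w z ∂P)
      (∫ z, deriv k ⟪a z, x⟫ • InnerProductSpace.rankOne ℝ (w z) (a z) ∂P) x := by
  -- Bounded features keep `⟪a z, y⟫` in a fixed compact interval for `y` in the unit ball around
  -- `x`, so the dominating function is a constant.
  obtain ⟨c, hc⟩ := (isCompact_Icc (a := -(R * (‖x‖ + 1)))
    (b := R * (‖x‖ + 1))).exists_bound_of_continuousOn hk'.continuousOn
  refine hasFDerivAt_integral_of_dominated_of_fderiv_le (bound := fun _ => c * (C * R))
    (Metric.ball_mem_nhds x one_pos) (Filter.Eventually.of_forall fun y =>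
      (integrable_comp_inner_smul hk.continuous ha hw hR hC y).aestronglyMeasurable)
    (integrable_comp_inner_smul hk.continuous ha hw hR hC x)
    ((hk'.comp_aestronglyMeasurable (ha.inner aestronglyMeasurable_const)).smul
      (aestronglyMeasurable_rankOne ha hw)) ?_ (integrable_const _)
    (ae_of_all _ fun z y _ => hasFDerivAt_comp_inner_smul hk _ _ _)
  filter_upwards [hR, hC] with z h1 h2 y hy
  rw [norm_smul, InnerProductSpace.norm_rankOne]
  have hy' : ‖y‖ ≤ ‖x‖ + 1 := by
    have := norm_le_norm_add_norm_sub x y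
    rw [mem_ball_iff_norm'] at hy
    linarith
  have h3 : ⟪a z, y⟫ ∈ Set.Icc (-(R * (‖x‖ + 1))) (R * (‖x‖ + 1)) := by
    have := (norm_nonneg _).trans h1
    exact abs_le.1 ((abs_real_inner_le_norm _ _).trans (by gcongr))
  have := (norm_nonneg _).trans h2
  exact mul_le_mul (hc _ h3) (by gcongr) (by positivity) ((norm_nonneg _).trans (hc _ h3))

variable {d : ℕ}

lemma hessian_eq {g : EuclideanSpace ℝ (Fin d) → ℝ}
    {G : EuclideanSpace ℝ (Fin d) → EuclideanSpace ℝ (Fin d)}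
    {H : EuclideanSpace ℝ (Fin d) →L[ℝ] EuclideanSpace ℝ (Fin d)} {x : EuclideanSpace ℝ (Fin d)}
    (hg : ∀ x, HasGradientAt g (G x) x) (hG : HasFDerivAt G H x) : hessian g x = H := by
  rw [hessian, gradient_eq hg, hG.fderiv]

lemma hasGradientAt_norm_sq (lam : ℝ) (x : EuclideanSpace ℝ (Fin d)) :
    HasGradientAt (fun x => lam / 2 * ‖x‖ ^ 2) (lam • x) x := by
  rw [hasGradientAt_iff_hasFDerivAt]
  refine ((hasFDerivAt_id x).norm_sq.const_mul (lam / 2)).congr_fderiv ?_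
  ext y
  simp
  ring

lemma hasGradientAt_linearModelLoss {Z : Type*} {a : Z → EuclideanSpace ℝ (Fin d)}
    {l : Z → ℝ → ℝ} (hl : ∀ z, Differentiable ℝ (l z)) (lam : ℝ) (z : Z)
    (x : EuclideanSpace ℝ (Fin d)) :
    HasGradientAt (fun x => linearModelLoss a l lam x z)
      (deriv (l z) ⟪a z, x⟫ • a z + lam • x) x := by
  rw [hasGradientAt_iff_hasFDerivAt]
  have h1 := hasFDerivAt_comp_inner_smul (hl z) (a z) x (1 : ℝ)
  have h2 := (hasGradientAt_iff_hasFDerivAt.1 (hasGradientAt_norm_sq lam x))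
  simp only [smul_eq_mul, mul_one] at h1
  refine (h1.add h2).congr_fderiv ?_
  ext y
  simp

/-- The Hessian of the empirical risk. -/
lemma hessian_sampleRisk {Z : Type*} {n : ℕ} (hn : 0 < n) {a : Z → EuclideanSpace ℝ (Fin d)}
    {l : Z → ℝ → ℝ} (hl1 : ∀ z, Differentiable ℝ (l z))
    (hl2 : ∀ z, Differentiable ℝ (deriv (l z))) (lam : ℝ) (s : Fin n → Z)
    (x : EuclideanSpace ℝ (Fin d)) :
    hessian (sampleRisk a l lam s) x = (1 / (n : ℝ)) • ∑ i, deriv (deriv (l (s i))) ⟪a (s i), x⟫ •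
      InnerProductSpace.rankOne ℝ (a (s i)) (a (s i)) + lam • ContinuousLinearMap.id ℝ _ := by
  have hn' : (n : ℝ) ≠ 0 := by exact_mod_cast hn.ne'
  refine hessian_eq (G := fun x => (1 / (n : ℝ)) •
    ∑ i, (deriv (l (s i)) ⟪a (s i), x⟫ • a (s i) + lam • x)) (fun x => ?_) ?_
  · rw [hasGradientAt_iff_hasFDerivAt]
    have h := (HasFDerivAt.fun_sum (u := Finset.univ) fun i _ => hasGradientAt_iff_hasFDerivAt.1
      (hasGradientAt_linearModelLoss (a := a) hl1 lam (s i) x)).const_mul (1 / (n : ℝ))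
    refine h.congr_fderiv ?_
    simp only [map_smul, map_sum]
  · have h := (HasFDerivAt.fun_sum (u := Finset.univ) fun i _ =>
      (hasFDerivAt_comp_inner_smul (hl2 (s i)) (a (s i)) x (a (s i))).add
        ((hasFDerivAt_id x).const_smul lam)).const_smul (1 / (n : ℝ))
    refine h.congr_fderiv ?_
    rw [Finset.sum_add_distrib, smul_add]
    simp [← Nat.cast_smul_eq_nsmul ℝ, smul_smul, hn']

/-- Equal second derivatives leave only an affine difference. Hence every loss is one fixed loss
plus an affine function, and the overall risk can be differentiated without any bound on the
individual derivatives `deriv (l z)`. -/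
lemma eq_add_of_deriv_deriv_eq {f g : ℝ → ℝ} (hf1 : Differentiable ℝ f)
    (hf2 : Differentiable ℝ (deriv f)) (hg1 : Differentiable ℝ g)
    (hg2 : Differentiable ℝ (deriv g)) (h : deriv (deriv f) = deriv (deriv g)) (t : ℝ) :
    f t = g t + (f 0 - g 0) + (deriv f 0 - deriv g 0) * t := by
  have h1 : ∀ t, deriv f t - deriv g t = deriv f 0 - deriv g 0 := fun t => by
    refine is_const_of_deriv_eq_zero (f := fun t => deriv f t - deriv g t) (hf2.sub hg2)
      (fun t => ?_) t 0
    rw [deriv_fun_sub (hf2 t) (hg2 t), h, sub_self]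
  have h2 := is_const_of_deriv_eq_zero
    (f := fun t => f t - g t - (deriv f 0 - deriv g 0) * t) (by fun_prop) (fun t => by
      have := (((hf1 t).hasDerivAt.sub (hg1 t).hasDerivAt).sub
        ((hasDerivAt_id t).const_mul (deriv f 0 - deriv g 0))).deriv
      refine this.trans ?_
      rw [h1]; ring) t 0
  simp only [mul_zero, sub_zero] at h2
  linarith

/-- The Hessian of the overall risk. -/
lemma hessian_overallRisk {Z : Type*} [MeasurableSpace Z] {P : Measure Z} [IsProbabilityMeasure P]
    {a : Z → EuclideanSpace ℝ (Fin d)} (ha : Measurable a) {l : Z → ℝ → ℝ}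
    (hl1 : ∀ z, Differentiable ℝ (l z)) (hl2 : ∀ z, Differentiable ℝ (deriv (l z)))
    (hl_common : ∀ z z', deriv (deriv (l z)) = deriv (deriv (l z')))
    (hl3 : ∀ z, Continuous (deriv (deriv (l z)))) (lam : ℝ)
    (hF : ∀ x : EuclideanSpace ℝ (Fin d), Integrable (fun z => l z ⟪a z, x⟫) P)
    {R : ℝ} (hR : ∀ᵐ z ∂P, ‖a z‖ ≤ R) (x : EuclideanSpace ℝ (Fin d)) :
    hessian (overallRisk P a l lam) x = ∫ z, deriv (deriv (l z)) ⟪a z, x⟫ •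
      InnerProductSpace.rankOne ℝ (a z) (a z) ∂P + lam • ContinuousLinearMap.id ℝ _ := by
  obtain ⟨z₀⟩ : Nonempty Z := P.nonempty_of_neZero
  set g := l z₀ with hg
  have ham := ha.aestronglyMeasurable (μ := P)
  have hgi : ∀ x, Integrable (fun z => g ⟪a z, x⟫) P := fun x => by
    simpa using integrable_comp_inner_smul (hl1 z₀).continuous ham
      (aestronglyMeasurable_const (b := (1 : ℝ))) hR (ae_of_all _ fun _ => le_rfl) x
  have hαi : Integrable (fun z => l z 0 - g 0) P := by
    have := hF 0
    simp only [inner_zero_right] at this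
    exact this.sub (integrable_const _)
  have hl : ∀ z t, l z t = g t + (l z 0 - g 0) + (deriv (l z) 0 - deriv g 0) * t := fun z =>
    eq_add_of_deriv_deriv_eq (hl1 z) (hl2 z) (hl1 z₀) (hl2 z₀) (hl_common z z₀)
  have hβi : ∀ x, Integrable (fun z => (deriv (l z) 0 - deriv g 0) * ⟪a z, x⟫) P := fun x => by
    refine (((hF x).sub (hgi x)).sub hαi).congr (ae_of_all _ fun z => ?_)
    simp only [Pi.sub_apply]
    rw [hl z ⟪a z, x⟫]
    ring
  -- The slopes times the features are integrable only after pairing with each `x`. The resulting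
  -- functional is linear on a finite-dimensional space, hence continuous, and contributes nothing
  -- to the Hessian.
  let Λ : EuclideanSpace ℝ (Fin d) →ₗ[ℝ] ℝ :=
    { toFun := fun x => ∫ z, (deriv (l z) 0 - deriv g 0) * ⟪a z, x⟫ ∂P
      map_add' := fun x y => by
        rw [← integral_add (hβi x) (hβi y)]
        simp only [inner_add_right, mul_add]
      map_smul' := fun c x => by
        rw [RingHom.id_apply, smul_eq_mul, ← integral_const_mul]
        simp only [real_inner_smul_right, mul_left_comm] }
  have hΛ : ∀ x, HasFDerivAt Λ Λ.toContinuousLinearMap x := fun x =>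
    Λ.toContinuousLinearMap.hasFDerivAt
  have hrisk : overallRisk P a l lam = fun x => ∫ z, g ⟪a z, x⟫ • (1 : ℝ) ∂P +
      ∫ z, (l z 0 - g 0) ∂P + Λ x + lam / 2 * ‖x‖ ^ 2 := by
    ext x
    have : ∀ z, linearModelLoss a l lam x z = g ⟪a z, x⟫ + (l z 0 - g 0) +
        (deriv (l z) 0 - deriv g 0) * ⟪a z, x⟫ + lam / 2 * ‖x‖ ^ 2 := fun z => by
      rw [linearModelLoss, hl z ⟪a z, x⟫]
    simp only [overallRisk, this, smul_eq_mul, mul_one]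
    rw [integral_add, integral_add, integral_add (hgi x) hαi]
    · simp [Λ]
    · exact (hgi x).add hαi
    · exact hβi x
    · exact ((hgi x).add hαi).add (hβi x)
    · exact integrable_const _
  have hg'a : ∀ x, Integrable (fun z => deriv g ⟪a z, x⟫ • a z) P :=
    integrable_comp_inner_smul (hl2 z₀).continuous ham ham hR hR
  refine hessian_eq (G := fun x => ∫ z, deriv g ⟪a z, x⟫ • a z ∂P +
    (InnerProductSpace.toDual ℝ _).symm Λ.toContinuousLinearMap + lam • x) (fun x => ?_) ?_
  · rw [hasGradientAt_iff_hasFDerivAt, hrisk]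
    have h1 := hasFDerivAt_integral_comp_inner_smul (hl1 z₀) (hl2 z₀).continuous ham
      (aestronglyMeasurable_const (b := (1 : ℝ))) hR (ae_of_all _ fun _ => le_rfl) x
    refine (((h1.add_const _).add (hΛ x)).add
      (hasGradientAt_iff_hasFDerivAt.1 (hasGradientAt_norm_sq lam x))).congr_fderiv ?_
    rw [map_add, map_add, LinearIsometryEquiv.apply_symm_apply]
    congr 2
    ext y
    rw [ContinuousLinearMap.integral_apply, InnerProductSpace.toDual_apply_apply, real_inner_comm,
      ← integral_inner (hg'a x)]
    · simp [real_inner_smul_right, real_inner_comm, hg]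
    · exact integrable_comp_inner_smul (hl2 z₀).continuous ham
        (aestronglyMeasurable_rankOne ham aestronglyMeasurable_const) hR
        (C := R) (by filter_upwards [hR] with z hz; simpa using hz) x
  · have h1 := hasFDerivAt_integral_comp_inner_smul (hl2 z₀) (hl3 z₀) ham ham hR hR x
    refine ((h1.add_const _).add ((hasFDerivAt_id x).const_smul lam)).congr_fderiv ?_
    simp only [hl_common _ z₀]

end Hessian

/-! ### From finite index sets to the full balls. -/

section Uniform

variable {Z : Type*} [MeasurableSpace Z] {P : Measure Z} [IsProbabilityMeasure P]
variable {V E : Type*} [NormedAddCommGroup V] [InnerProductSpace ℝ V]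
  [SecondCountableTopology V] [MeasurableSpace V] [BorelSpace V]
  [NormedAddCommGroup E] [InnerProductSpace ℝ E]
  [SecondCountableTopology E] [MeasurableSpace E] [BorelSpace E]

/-- A high-probability bound on the centered sums of `z ↦ h ⟪a z, x⟫ * ⟪b z, W⟫`, uniform over `x`
in a ball and `W` in the unit ball. -/
lemma measure_pi_not_forall_sum_le {n : ℕ} (hn : 0 < n)
    {a : Z → E} {b : Z → V} {h : ℝ → ℝ} {R D B δ : ℝ} {M : ℝ≥0}
    (hR : 0 ≤ R) (hD : 0 ≤ D) (ha : ∀ z, ‖a z‖ ≤ R) (hb : ∀ z, ‖b z‖ ≤ R ^ 2)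
    (ham : Measurable a) (hbm : Measurable b)
    (hM : LipschitzWith M h) (h0 : ∀ s, 0 ≤ h s) (hB : ∀ s, h s ≤ B)
    (hδ0 : 0 < δ) (hδ1 : δ ≤ 1) :
    (Measure.pi fun _ : Fin n => P) {z | ¬ ∀ (x : E) (W : V), ‖x‖ ≤ D → ‖W‖ ≤ 1 →
      ∑ i, (h ⟪a (z i), x⟫ * ⟪b (z i), W⟫ - ∫ z, h ⟪a z, x⟫ * ⟪b z, W⟫ ∂P) ≤
      √(4 * Real.pi) * R ^ 2 * √n *
        (B * (2 + √(1 / (2 * Real.pi) * Real.log (1 / δ))) + R * M * D)} ≤ ENNReal.ofReal δ := by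
  set T := √(4 * Real.pi) * R ^ 2 * √n *
    (B * (2 + √(1 / (2 * Real.pi) * Real.log (1 / δ))) + R * M * D) with hT
  let K := {q : E × V // ‖q.1‖ ≤ D ∧ ‖q.2‖ ≤ 1}
  have : Nonempty K := ⟨⟨0, by simpa using hD, by simp⟩⟩
  let u : ℕ → K := TopologicalSpace.denseSeq K
  let S : K → (Fin n → Z) → ℝ := fun q z =>
    ∑ i, (h ⟪a (z i), q.1.1⟫ * ⟪b (z i), q.1.2⟫ - ∫ z, h ⟪a z, q.1.1⟫ * ⟪b z, q.1.2⟫ ∂P)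
  -- The events for the first `m + 1` points of a dense sequence increase with `m` and each has
  -- measure at most `δ`, so their union does too, without a union bound.
  let A : ℕ → Set (Fin n → Z) := fun m => {z | T < ⨆ t : Fin (m + 1), S (u t) z}
  have hterm : ∀ y, Continuous fun q : K => h ⟪a y, q.1.1⟫ * ⟪b y, q.1.2⟫ := fun y => by
    have := hM.continuous
    fun_prop
  have hint : Continuous fun q : K => ∫ z, h ⟪a z, q.1.1⟫ * ⟪b z, q.1.2⟫ ∂P := by
    refine continuous_of_dominated (bound := fun _ => B * R ^ 2) (fun q => ?_)
      (fun q => ae_of_all _ fun y => ?_) (integrable_const _) (ae_of_all _ hterm)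
    · have := hM.continuous.measurable
      exact Measurable.aestronglyMeasurable (by fun_prop)
    · rw [norm_mul, Real.norm_of_nonneg (h0 _)]
      refine mul_le_mul (hB _) ?_ (norm_nonneg _) ((h0 0).trans (hB 0))
      exact (abs_real_inner_le_norm _ _).trans
        ((mul_le_mul (hb y) q.2.2 (norm_nonneg _) (by positivity)).trans_eq (mul_one _))
  have hS : ∀ z, Continuous fun q => S q z := fun z =>
    continuous_finsetSum _ fun i _ => (hterm (z i)).sub hint
  have hA : Monotone A := monotone_nat_of_le_succ fun m z hz => by
    rw [Set.mem_ofPred_eq] at hz ⊢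
    refine hz.trans_le (ciSup_le fun t => ?_)
    exact le_ciSup_of_finite (fun t : Fin (m + 1 + 1) => S (u t) z) t.castSucc
  calc _ ≤ (Measure.pi fun _ : Fin n => P) (⋃ m, A m) := by
        refine measure_mono fun z hz => ?_
        by_contra hcon
        refine hz fun x W hx hW => ?_
        refine (TopologicalSpace.denseRange_denseSeq K).induction_on
          (p := fun q : K => S q z ≤ T) ⟨(x, W), hx, hW⟩ (isClosed_le (hS z) continuous_const) ?_
        intro k
        by_contra! hk
        refine hcon (Set.mem_iUnion.2 ⟨k, hk.trans_le ?_⟩)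
        exact le_ciSup_of_finite (fun t : Fin (k + 1) => S (u t) z) (Fin.last k)
    _ = ⨆ m, (Measure.pi fun _ : Fin n => P) (A m) := hA.measure_iUnion
    _ ≤ ENNReal.ofReal δ := by
        refine iSup_le fun m => ?_
        rw [← ofReal_measureReal]
        refine ENNReal.ofReal_le_ofReal ?_
        exact measureReal_pi_lt_ciSup_sum_le (P := P) hn hR ha hb
          (x := fun t : Fin (m + 1) => (u t).1.1) (W := fun t => (u t).1.2) (fun t => (u t).2.1)
          (fun t => (u t).2.2) (fun t => by fun_prop) (fun t => by fun_prop) hM h0 hB hδ0 hδ1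

end Uniform

/-! ### Outer products and the operator norm as a bilinear supremum. -/

section OuterProduct

variable {d : ℕ}

/-- The outer product `v wᵀ`, as a vector with the Frobenius norm. -/
noncomputable def outerProduct (v w : EuclideanSpace ℝ (Fin d)) :
    EuclideanSpace ℝ (Fin d × Fin d) :=
  WithLp.toLp 2 fun p => v p.1 * w p.2

lemma inner_outerProduct (a b v w : EuclideanSpace ℝ (Fin d)) :
    ⟪outerProduct a b, outerProduct v w⟫ = ⟪a, v⟫ * ⟪b, w⟫ := by
  simp only [outerProduct, PiLp.inner_apply, Fintype.sum_prod_type, Finset.sum_mul_sum]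
  refine Finset.sum_congr rfl fun i _ => Finset.sum_congr rfl fun j _ => ?_
  simp
  ring

lemma norm_outerProduct (v w : EuclideanSpace ℝ (Fin d)) :
    ‖outerProduct v w‖ = ‖v‖ * ‖w‖ := by
  rw [← sq_eq_sq₀ (norm_nonneg _) (by positivity), ← real_inner_self_eq_norm_sq,
    inner_outerProduct, real_inner_self_eq_norm_sq, real_inner_self_eq_norm_sq, mul_pow]

lemma measurable_outerProduct_self {Z : Type*} [MeasurableSpace Z]
    {a : Z → EuclideanSpace ℝ (Fin d)} (ha : Measurable a) :
    Measurable fun z => outerProduct (a z) (a z) := by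
  unfold outerProduct
  fun_prop

end OuterProduct

lemma ContinuousLinearMap.opNorm_le_of_inner_le {E : Type*} [NormedAddCommGroup E]
    [InnerProductSpace ℝ E] {T : E →L[ℝ] E} {c : ℝ}
    (h : ∀ v w, ‖v‖ ≤ 1 → ‖w‖ ≤ 1 → ⟪w, T v⟫ ≤ c) : ‖T‖ ≤ c := by
  have hc : 0 ≤ c := by simpa using h 0 0 (by simp) (by simp)
  refine ContinuousLinearMap.opNorm_le_of_unit_norm hc fun v hv => ?_
  -- Test against the direction of `T v`; when `T v = 0` this vector is 0 and the claim is `0 ≤ c`.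
  have h1 := h v (‖T v‖⁻¹ • T v) hv.le (by
    rw [norm_smul, norm_inv, norm_norm]
    exact inv_mul_le_one)
  rcases (norm_nonneg (T v)).eq_or_lt with h0 | h0
  · rwa [← h0]
  · rwa [real_inner_smul_left, real_inner_self_eq_norm_sq, sq, inv_mul_cancel_left₀ h0.ne'] at h1

lemma integral_inner_smul_rankOne {Z : Type*} [MeasurableSpace Z] {P : Measure Z} {E : Type*}
    [NormedAddCommGroup E] [InnerProductSpace ℝ E] [CompleteSpace E] {c : Z → ℝ} {a : Z → E}
    (h : Integrable (fun z => c z • InnerProductSpace.rankOne ℝ (a z) (a z)) P) (v w : E) :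
    ⟪w, (∫ z, c z • InnerProductSpace.rankOne ℝ (a z) (a z) ∂P) v⟫ =
      ∫ z, c z * (⟪a z, v⟫ * ⟪a z, w⟫) ∂P := by
  refine (((innerSL ℝ w).comp
    (ContinuousLinearMap.apply ℝ E v)).integral_comp_comm h).symm.trans ?_
  refine integral_congr_ae (ae_of_all _ fun z => ?_)
  simp [real_inner_comm]

/-! ### The main theorem. -/

theorem mainTheorem3
    {Ω : Type*} [MeasurableSpace Ω] (Pr : Measure Ω) [IsProbabilityMeasure Pr]
    {Z : Type*} [MeasurableSpace Z] (P : Measure Z) [IsProbabilityMeasure P]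
    (d n : ℕ) (hn : 0 < n)
    -- the linear model: features, scalar losses with a common second derivative, regularization
    (a : Z → EuclideanSpace ℝ (Fin d)) (ha : Measurable a)
    (l : Z → ℝ → ℝ)
    (hl1 : ∀ z, Differentiable ℝ (l z)) (hl2 : ∀ z, Differentiable ℝ (deriv (l z)))
    (hl_common : ∀ z z', deriv (deriv (l z)) = deriv (deriv (l z')))
    (lam : ℝ) (hlam : 0 < lam)
    -- the overall risk is well defined
    (hF : ∀ x : EuclideanSpace ℝ (Fin d), Integrable (fun z => l z ⟪a z, x⟫) P)
    -- the sample consists of independent data points with law `P`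
    (s : Fin n → Ω → Z) (hs_meas : ∀ i, Measurable (s i))
    (hs_law : ∀ i, Pr.map (s i) = P) (hs_indep : iIndepFun s Pr)
    -- bounds on the features and on the second derivatives of the losses
    (R D B : ℝ) (M : ℝ≥0) (hD : 0 ≤ D)
    (hR : ∀ᵐ z ∂P, ‖a z‖ ≤ R)
    (hM : ∀ z, LipschitzWith M (deriv (deriv (l z))))
    (hB : ∀ᵐ z ∂P, ∀ x ∈ Metric.closedBall (0 : EuclideanSpace ℝ (Fin d)) D,
      0 ≤ deriv (deriv (l z)) ⟪a z, x⟫ ∧ deriv (deriv (l z)) ⟪a z, x⟫ ≤ B)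
    (δ : ℝ) (hδ0 : 0 < δ) (hδ1 : δ ≤ 1) :
    ENNReal.ofReal (1 - δ) ≤
      Pr {ω | ∀ x ∈ Metric.closedBall (0 : EuclideanSpace ℝ (Fin d)) D,
        ‖hessian (sampleRisk a l lam (fun i => s i ω)) x - hessian (overallRisk P a l lam) x‖ ≤
          √(4 * Real.pi) * (R ^ 2 / √(n : ℝ)) *
            (B * (2 + √(1 / (2 * Real.pi) * Real.log (1 / δ))) + R * M * D)} := by
  classical
  obtain ⟨z₀⟩ : Nonempty Z := P.nonempty_of_neZero
  set h := deriv (deriv (l z₀)) with hh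
  have hhl : ∀ z, deriv (deriv (l z)) = h := fun z => hl_common z z₀
  simp only [hhl] at hB
  have hB0 : 0 ≤ B := by
    obtain ⟨z, hz⟩ := hB.exists
    obtain ⟨h1, h2⟩ := hz 0 (Metric.mem_closedBall_self hD)
    exact h1.trans h2
  have hR0 : 0 ≤ R := by
    obtain ⟨z, hz⟩ := hR.exists
    exact (norm_nonneg _).trans hz
  -- clamp the second derivative and truncate the features, so that the bounds hold everywhere
  let k : ℝ → ℝ := fun s => max (min (h s) B) 0
  have hkM : LipschitzWith M k := ((hM z₀).min_const B).max_const 0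
  have hk0 : ∀ s, 0 ≤ k s := fun s => le_max_right _ _
  have hkB : ∀ s, k s ≤ B := fun s => max_le (min_le_right _ _) hB0
  have hkh : ∀ s, 0 ≤ h s → h s ≤ B → k s = h s := fun s h1 h2 => by
    simp only [k, min_eq_left h2, max_eq_left h1]
  let a' : Z → EuclideanSpace ℝ (Fin d) := fun z => if ‖a z‖ ≤ R then a z else 0
  have ha'm : Measurable a' :=
    Measurable.ite (measurableSet_le ha.norm measurable_const) ha measurable_const
  have ha'R : ∀ z, ‖a' z‖ ≤ R := fun z => by
    simp only [a']
    split_ifs with hz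
    · exact hz
    · simpa using hR0
  have hgood : ∀ᵐ z ∂P, a' z = a z ∧ ∀ x ∈ Metric.closedBall (0 : EuclideanSpace ℝ (Fin d)) D,
      k ⟪a z, x⟫ = h ⟪a z, x⟫ := by
    filter_upwards [hR, hB] with z h1 h2
    exact ⟨if_pos h1, fun x hx => hkh _ (h2 x hx).1 (h2 x hx).2⟩
  have hPr : Pr.map (fun ω i => s i ω) = Measure.pi fun _ : Fin n => P := by
    rw [(iIndepFun_iff_map_fun_eq_pi_map fun i => (hs_meas i).aemeasurable).1 hs_indep]
    simp only [hs_law]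
  have hsm : Measurable fun ω i => s i ω := measurable_pi_lambda _ hs_meas
  have hbad := measure_pi_not_forall_sum_le (P := P) hn (b := fun z => outerProduct (a' z) (a' z))
    hR0 hD ha'R (fun z => by
      rw [norm_outerProduct, sq]
      exact mul_le_mul (ha'R z) (ha'R z) (norm_nonneg _) hR0)
    ha'm (measurable_outerProduct_self ha'm) hkM hk0 hkB hδ0 hδ1
  set good : Set (Fin n → Z) := {z | ∀ (x : EuclideanSpace ℝ (Fin d))
    (W : EuclideanSpace ℝ (Fin d × Fin d)), ‖x‖ ≤ D → ‖W‖ ≤ 1 →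
    ∑ i, (k ⟪a' (z i), x⟫ * ⟪outerProduct (a' (z i)) (a' (z i)), W⟫ -
      ∫ z, k ⟪a' z, x⟫ * ⟪outerProduct (a' z) (a' z), W⟫ ∂P) ≤
    √(4 * Real.pi) * R ^ 2 * √n *
      (B * (2 + √(1 / (2 * Real.pi) * Real.log (1 / δ))) + R * M * D)} with hgd
  have hPrbad : Pr ((fun ω i => s i ω) ⁻¹' goodᶜ) ≤ ENNReal.ofReal δ := by
    refine (Measure.le_map_apply hsm.aemeasurable _).trans ?_
    rw [hPr]
    exact hbad
  -- Subadditivity on `good` and its complement suffices, so `good` need not be shown measurable.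
  have hPrgood : ENNReal.ofReal (1 - δ) ≤ Pr ((fun ω i => s i ω) ⁻¹' good) := by
    rw [ENNReal.ofReal_sub _ hδ0.le, ENNReal.ofReal_one, tsub_le_iff_right]
    calc 1 = Pr Set.univ := measure_univ.symm
      _ ≤ Pr ((fun ω i => s i ω) ⁻¹' good ∪ (fun ω i => s i ω) ⁻¹' goodᶜ) :=
          measure_mono (by rw [← Set.preimage_union, Set.union_compl_self, Set.preimage_univ])
      _ ≤ _ := (measure_union_le _ _).trans (by gcongr)
  have hsgood : ∀ᵐ ω ∂Pr, ∀ i, a' (s i ω) = a (s i ω) ∧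
      ∀ x ∈ Metric.closedBall (0 : EuclideanSpace ℝ (Fin d)) D,
        k ⟪a (s i ω), x⟫ = h ⟪a (s i ω), x⟫ := by
    refine ae_all_iff.2 fun i => ?_
    have := hgood
    rw [← hs_law i] at this
    exact ae_of_ae_map (hs_meas i).aemeasurable this
  refine hPrgood.trans (measure_mono_ae ?_)
  filter_upwards [hsgood] with ω hω hωg x hx
  have hn' : (0 : ℝ) < n := by exact_mod_cast hn
  rw [hessian_sampleRisk hn hl1 hl2, hessian_overallRisk ha hl1 hl2 hl_common
    (fun z => (hM z).continuous) lam hF hR, add_sub_add_right_eq_sub]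
  refine ContinuousLinearMap.opNorm_le_of_inner_le fun v w hv hw => ?_
  have hx' : ‖x‖ ≤ D := mem_closedBall_zero_iff.1 hx
  -- Specializing `W` to `v wᵀ` turns the Frobenius pairing with `a aᵀ` into `⟪a, v⟫ * ⟪a, w⟫`. The
  -- clamped data can then be replaced by the original, since they agree almost surely for `x` in
  -- the ball.
  have key := hωg x (outerProduct v w) hx' (by
    rw [norm_outerProduct]
    exact mul_le_one₀ hv (norm_nonneg _) hw)
  simp only [inner_outerProduct] at key
  have hcongr : ∫ z, k ⟪a' z, x⟫ * (⟪a' z, v⟫ * ⟪a' z, w⟫) ∂P =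
      ∫ z, h ⟪a z, x⟫ * (⟪a z, v⟫ * ⟪a z, w⟫) ∂P := by
    refine integral_congr_ae ?_
    filter_upwards [hgood] with z hz
    rw [hz.1, hz.2 x hx]
  have hsum : ∀ i, k ⟪a' (s i ω), x⟫ * (⟪a' (s i ω), v⟫ * ⟪a' (s i ω), w⟫) =
      h ⟪a (s i ω), x⟫ * (⟪a (s i ω), v⟫ * ⟪a (s i ω), w⟫) := fun i => by
    rw [(hω i).1, (hω i).2 x hx]
  simp only [hcongr, hsum] at key
  rw [Finset.sum_sub_distrib, Finset.sum_const, Finset.card_univ, Fintype.card_fin,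
    nsmul_eq_mul] at key
  have hint := integrable_comp_inner_smul (hM z₀).continuous ha.aestronglyMeasurable
    (aestronglyMeasurable_rankOne ha.aestronglyMeasurable ha.aestronglyMeasurable) hR
    (C := R * R) (by
      filter_upwards [hR] with z hz
      rw [InnerProductSpace.norm_rankOne]
      exact mul_le_mul hz hz (norm_nonneg _) hR0) x
  have e1 : ⟪w, ((1 / (n : ℝ)) • ∑ i, h ⟪a (s i ω), x⟫ •
      InnerProductSpace.rankOne ℝ (a (s i ω)) (a (s i ω))) v⟫ =
      1 / n * ∑ i, h ⟪a (s i ω), x⟫ * (⟪a (s i ω), v⟫ * ⟪a (s i ω), w⟫) := by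
    simp [inner_sum, real_inner_smul_right, real_inner_comm]
  simp only [hhl]
  rw [sub_apply, inner_sub_right, e1, integral_inner_smul_rankOne hint]
  rw [← sub_nonneg] at key ⊢
  refine (mul_nonneg (one_div_nonneg.2 hn'.le) key).trans_eq ?_
  have hsq : (n : ℝ) = √n * √n := (Real.mul_self_sqrt hn'.le).symm
  have hs0 : √(n : ℝ) ≠ 0 := (Real.sqrt_pos.2 hn').ne'
  have e2 : 1 / (n : ℝ) * √n = 1 / √n := by
    nth_rw 1 [hsq]
    field_simp
  have e3 : 1 / (n : ℝ) * n = 1 := by field_simp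
  linear_combination (√(4 * Real.pi) * R ^ 2 *
    (B * (2 + √(1 / (2 * Real.pi) * Real.log (1 / δ))) + R * M * D)) * e2 +
    (∫ z, h ⟪a z, x⟫ * (⟪a z, v⟫ * ⟪a z, w⟫) ∂P) * e3
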